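/- Let $T\in(0,\infty]$, let $(\Omega,\mathcal F,(\mathcal F_t)_t,P)$ be a filtered probability space, the time index $t$ ranging over $[0,T]$ (over $[0,\infty)$ if $T=\infty$), and let $L=(L_t)_t$ be a real-valued Lévy process on it: $L$ is adapted and càdlàg, $L_0=0$ a.s., $L_t-L_s$ is independent of $\mathcal F_s$ for $s<t$, the law of $L_{s+h}-L_s$ does not depend on $s$, and $L$ is stochastically continuous. Let $(b_0,c,\nu)$ be the Lévy triplet of $L$, that is, $b_0\in\mathbb R$, $c\ge 0$, $\nu$ is a Borel measure on $\mathbb R$ with $\nu(\{0\})=0$ and $\int_{\mathbb R}(1\wedge|x|^2)\,\nu(dx)<\infty$, and $$E\big[e^{iuL_t}\big]=\exp\Big[t\Big(iub_0-\frac{u^2c}{2}+\int_{\mathbb R}\big(e^{iux}-1-iux1_{\{|x|<1\}}\big)\nu(dx)\Big)\Big]\qquad\text{for all } t \text{ and all } u\in\mathbb R .$$ Assume that $L$ has finite first moment, $E[|L_t|]<\infty$ for all $t$. Then $\int_{\{|x|\ge1\}}|x|\,\nu(dx)<\infty$, so that the drift of $L$ with the big jumps compensated as well, $$b:=b_0+\int_{\{|x|\ge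 1\}}x\,\nu(dx),$$ is well defined, and: 1. $L$ is a martingale (with respect to $(\mathcal F_t)_t$ and $P$) if and only if $b=0$; 2. if $b>0$, then $L$ is a submartingale; 3. if $b<0$, then $L$ is a supermartingale. -/

import Mathlib

open MeasureTheory ProbabilityTheory Filter Topology
open scoped NNReal ENNReal

/-- The time set `{t ∈ [0, ∞) : t ≤ T}` of a horizon `T ∈ [0, ∞]`: the interval `[0, T]` if
`T < ∞`, and `[0, ∞)` if `T = ∞`. It carries the order and the topology of `ℝ≥0`. -/
abbrev TimeSet (T : ℝ≥0∞) : Type := {t : ℝ≥0 // (t : ℝ≥0∞) ≤ T}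

/-- A real-valued Lévy process `(L_t)_{0 ≤ t ≤ T}` on the filtered probability space
`(Ω, mΩ, ℱ, P)`. -/
structure IsLevyProcess {Ω : Type*} {mΩ : MeasurableSpace Ω} {T : ℝ≥0∞}
    (L : TimeSet T → Ω → ℝ) (ℱ : Filtration (TimeSet T) mΩ) (P : Measure Ω) : Prop where
  /-- `L` is adapted to the filtration. -/
  adapted : ∀ t, Measurable[ℱ t] (L t)
  /-- Every path is right-continuous. -/
  right_continuous : ∀ ω t, ContinuousWithinAt (fun s => L s ω) (Set.Ici t) t
  /-- Every path has finite left limits (this is void at `t = 0`). -/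
  left_limits : ∀ ω t, ∃ l : ℝ, Tendsto (fun s => L s ω) (𝓝[<] t) (𝓝 l)
  /-- `L_0 = 0` almost surely. -/
  zero : ∀ᵐ ω ∂P, L ⟨0, zero_le⟩ ω = 0
  /-- Independent increments: `L_t - L_s` is independent of `ℱ_s`. -/
  indep_increments : ∀ s t, s < t →
    Indep (MeasurableSpace.comap (fun ω => L t ω - L s ω) inferInstance) (ℱ s) P
  /-- Stationary increments: the law of `L_{s + h} - L_s` does not depend on `s`. -/
  stationary_increments : ∀ (h : ℝ≥0) (s t s' t' : TimeSet T),
    (t : ℝ≥0) = s + h → (t' : ℝ≥0) = s' + h →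
    P.map (fun ω => L t ω - L s ω) = P.map (fun ω => L t' ω - L s' ω)
  /-- Stochastic continuity. -/
  stochastically_continuous : ∀ (t : TimeSet T) (ε : ℝ), 0 < ε →
    Tendsto (fun s => P {ω | ε < |L t ω - L s ω|}) (𝓝 t) (𝓝 0)

/-- A Lévy measure: a Borel measure on `ℝ` with `ν {0} = 0` and `∫ (1 ∧ |x|²) ν(dx) < ∞`. -/
structure IsLevyMeasure (ν : Measure ℝ) : Prop where
  zero : ν {0} = 0
  lintegral_lt_top : ∫⁻ x, ENNReal.ofReal (min 1 (|x| ^ 2)) ∂ν < ∞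

/-- The Lévy exponent
`ψ(u) = i u b - u² c / 2 + ∫ (exp(i u x) - 1 - i u x 1_{|x| < 1}) ν(dx)`. -/
noncomputable def levyExponent (b : ℝ) (c : ℝ≥0) (ν : Measure ℝ) (u : ℝ) : ℂ :=
  Complex.I * u * b - (u : ℂ) ^ 2 * ((c : ℝ) : ℂ) / 2 +
    ∫ x : ℝ, (Complex.exp (Complex.I * u * x) - 1 -
      Complex.I * u * (({x : ℝ | |x| < 1}.indicator (fun y => y) x : ℝ) : ℂ)) ∂ν

/-- `(b, c, ν)` is the Lévy triplet (characteristic triplet, with respect to the truncation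
`1_{|x| < 1}`) of `L`: `ν` is a Lévy measure and the Lévy-Khintchine formula
`E[exp(i u L_t)] = exp(t ψ(u))` holds. -/
structure HasLevyTriplet {Ω : Type*} {mΩ : MeasurableSpace Ω} {T : ℝ≥0∞}
    (L : TimeSet T → Ω → ℝ) (P : Measure Ω) (b : ℝ) (c : ℝ≥0) (ν : Measure ℝ) : Prop where
  isLevyMeasure : IsLevyMeasure ν
  levy_khintchine : ∀ (t : TimeSet T) (u : ℝ),
    ∫ ω, Complex.exp (Complex.I * u * L t ω) ∂P
      = Complex.exp (((t : ℝ≥0) : ℝ) * levyExponent b c ν u)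

/-- The drift once the big jumps are compensated too,
`b' = b + ∫_{|x| ≥ 1} x ν(dx)`: it is the drift in the canonical decomposition
`L_t = b' t + √c W_t + ∫_0^t ∫ x (μ^L - ν^L)(ds, dx)`, where `b` is the drift in the triplet
with respect to the truncation `1_{|x| < 1}`. The integral is meant when
`∫_{|x| ≥ 1} |x| ν(dx) < ∞`. -/
noncomputable def compensatedDrift (b : ℝ) (ν : Measure ℝ) : ℝ :=
  b + ∫ x in {x : ℝ | 1 ≤ |x|}, x ∂ν

/-! Once the big jumps are ν-integrable, differentiating both sides of the Lévy-Khintchine formula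
at `u = 0` gives E[L_t] = t b. Independence of increments then yields E[L_t | ℱ_s] = L_s + (t - s)
b, and everything is read off the sign of b.

The main work is to transfer the first moment from L_t to ν. For small u, t ∫_{|x| ≥ 1} (1 - cos ux)
ν(dx) ≤ -t Re ψ(u) ≤ 2 E[1 - cos(u L_t)]. Dividing by u², integrating over (0, δ) and applying
Tonelli turns both ends into integrals of `cosWeight`, which is at most 3|x| everywhere
(`cosWeight_le`) and at least a multiple of |x| for |x| ≥ 1 (`le_cosWeight`). -/

/-- The weight `∫_{0 < u < δ} (1 - cos (u x)) / u² du`, which is comparable to `|x|` for large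
`x`. -/
noncomputable def cosWeight (δ x : ℝ) : ℝ≥0∞ :=
  ∫⁻ u in Set.Ioo 0 δ, ENNReal.ofReal ((1 - Real.cos (u * x)) / u ^ 2)

/-- Split at u = 1/|x|: below, the integrand is at most x², contributing |x|; above, it is at most
2/u², contributing 2|x|. -/
theorem cosWeight_le (δ x : ℝ) : cosWeight δ x ≤ ENNReal.ofReal (3 * |x|) := by
  rcases eq_or_ne x 0 with rfl | hx
  · simp [cosWeight]
  have hx' : 0 < |x| := abs_pos.2 hx
  have hr : 0 < |x|⁻¹ := inv_pos.2 hx'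
  have hsub : Set.Ioo 0 δ ⊆ Set.Ioc 0 |x|⁻¹ ∪ Set.Ioi |x|⁻¹ := by
    rintro u ⟨hu, -⟩
    rcases le_or_gt u |x|⁻¹ with h | h
    exacts [Or.inl ⟨hu, h⟩, Or.inr h]
  have h1 : ∫⁻ u in Set.Ioc 0 |x|⁻¹, ENNReal.ofReal ((1 - Real.cos (u * x)) / u ^ 2)
      ≤ ENNReal.ofReal |x| := by
    calc _ ≤ ∫⁻ _ in Set.Ioc 0 |x|⁻¹, ENNReal.ofReal (|x| ^ 2) := by
          refine setLIntegral_mono measurable_const fun u hu => ENNReal.ofReal_le_ofReal ?_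
          have := hu.1
          rw [div_le_iff₀ (by positivity)]
          have := Real.one_sub_sq_div_two_le_cos (x := u * x)
          rw [sq_abs]
          nlinarith [sq_nonneg (u * x)]
      _ = ENNReal.ofReal |x| := by
          rw [setLIntegral_const, Real.volume_Ioc, ← ENNReal.ofReal_mul (by positivity)]
          congr 1
          field_simp
          simp
  have h2 : ∫⁻ u in Set.Ioi |x|⁻¹, ENNReal.ofReal ((1 - Real.cos (u * x)) / u ^ 2)
      ≤ ENNReal.ofReal (2 * |x|) := by
    calc _ ≤ ∫⁻ u in Set.Ioi |x|⁻¹, ENNReal.ofReal (2 * u ^ (-2 : ℝ)) := by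
          refine setLIntegral_mono (by fun_prop) fun u hu => ENNReal.ofReal_le_ofReal ?_
          have hu0 : 0 < u := hr.trans hu
          rw [Real.rpow_neg hu0.le, Real.rpow_ofNat, ← div_eq_mul_inv]
          gcongr
          linarith [Real.neg_one_le_cos (u * x)]
      _ = ENNReal.ofReal (2 * |x|) := by
          rw [← ofReal_integral_eq_lintegral_ofReal, integral_const_mul,
            integral_Ioi_rpow_of_lt (by norm_num) hr]
          · norm_num [Real.rpow_neg_one]
          · exact (integrableOn_Ioi_rpow_of_lt (by norm_num) hr).const_mul 2
          · filter_upwards [ae_restrict_mem measurableSet_Ioi] with u hu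
            have hu0 : 0 < u := hr.trans hu
            positivity
  calc cosWeight δ x ≤ _ := lintegral_mono_set hsub
    _ ≤ _ := lintegral_union_le _ _ _
    _ ≤ _ := add_le_add h1 h2
    _ = _ := by
      rw [← ENNReal.ofReal_add (by positivity) (by positivity)]
      ring_nf

/-- For u < δ/|x| one has |ux| < 1 < π, so 1 - cos(ux) ≥ 2(ux)²/π². As |x| ≥ 1, this range of u lies
in (0, δ). -/
theorem le_cosWeight {δ x : ℝ} (hδ0 : 0 < δ) (hδ : δ ≤ 1) (hx : 1 ≤ |x|) :
    ENNReal.ofReal (2 / Real.pi ^ 2 * δ * |x|) ≤ cosWeight δ x := by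
  have hx' : 0 < |x| := by linarith
  calc ENNReal.ofReal (2 / Real.pi ^ 2 * δ * |x|)
      = ∫⁻ _ in Set.Ioo 0 (δ / |x|), ENNReal.ofReal (2 / Real.pi ^ 2 * |x| ^ 2) := by
        rw [setLIntegral_const, Real.volume_Ioo, ← ENNReal.ofReal_mul (by positivity)]
        congr 1
        field_simp
        simp
    _ ≤ ∫⁻ u in Set.Ioo 0 (δ / |x|), ENNReal.ofReal ((1 - Real.cos (u * x)) / u ^ 2) := by
        refine setLIntegral_mono (by fun_prop) fun u hu => ENNReal.ofReal_le_ofReal ?_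
        have hu0 := hu.1
        rw [le_div_iff₀ (by positivity)]
        have h := Real.cos_le_one_sub_mul_cos_sq (x := u * x) (by
          rw [abs_mul, abs_of_pos hu0]
          have := (lt_div_iff₀ hx').1 hu.2
          linarith [Real.pi_gt_three])
        rw [sq_abs]
        linarith [mul_pow u x 2]
    _ ≤ cosWeight δ x := lintegral_mono_set
        (Set.Ioo_subset_Ioo_right (div_le_self hδ0.le hx))

theorem lintegral_cosWeight {α : Type*} [MeasurableSpace α] {μ : Measure α} [SFinite μ]
    {X : α → ℝ} (hX : Measurable X) (δ : ℝ) :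
    ∫⁻ a, cosWeight δ (X a) ∂μ
      = ∫⁻ u in Set.Ioo 0 δ, ∫⁻ a, ENNReal.ofReal ((1 - Real.cos (u * X a)) / u ^ 2) ∂μ :=
  lintegral_lintegral_swap (by fun_prop)

/-! ### The Lévy measure and the Lévy exponent near zero -/

namespace IsLevyMeasure

variable {ν : Measure ℝ}

theorem integrableOn_sq (hν : IsLevyMeasure ν) :
    IntegrableOn (fun x : ℝ => |x| ^ 2) {x : ℝ | |x| < 1} ν := by
  refine ⟨by fun_prop, ?_⟩
  rw [hasFiniteIntegral_iff_ofReal (ae_of_all _ fun x => by positivity)]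
  refine lt_of_le_of_lt ?_ hν.lintegral_lt_top
  refine (setLIntegral_mono (by fun_prop) fun x hx => ENNReal.ofReal_le_ofReal ?_).trans
    (setLIntegral_le_lintegral {x : ℝ | |x| < 1} _)
  have hx : |x| < 1 := hx
  exact le_min (pow_le_one₀ (abs_nonneg x) hx.le) le_rfl

theorem measure_one_le_abs_lt_top (hν : IsLevyMeasure ν) : ν {x : ℝ | 1 ≤ |x|} < ∞ := by
  refine lt_of_le_of_lt ?_ hν.lintegral_lt_top
  have hm : MeasurableSet {x : ℝ | 1 ≤ |x|} := measurableSet_le measurable_const (by fun_prop)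
  rw [← setLIntegral_one]
  refine (setLIntegral_mono (by fun_prop) fun x hx => ?_).trans
    (setLIntegral_le_lintegral {x : ℝ | 1 ≤ |x|} _)
  have hx : 1 ≤ |x| := hx
  rw [min_eq_left (one_le_pow₀ hx), ENNReal.ofReal_one]

end IsLevyMeasure

/-- The integrand `exp (i u x) - 1 - i u x 1_{|x| < 1}` of the Lévy exponent. -/
noncomputable def levyIntegrand (u x : ℝ) : ℂ :=
  Complex.exp (Complex.I * u * x) - 1 -
    Complex.I * u * (({x : ℝ | |x| < 1}.indicator (fun y => y) x : ℝ) : ℂ)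

theorem measurableSet_abs_lt_one : MeasurableSet {x : ℝ | |x| < 1} :=
  measurableSet_lt (by fun_prop) measurable_const

theorem measurableSet_one_le_abs : MeasurableSet {x : ℝ | 1 ≤ |x|} :=
  measurableSet_le measurable_const (by fun_prop)

theorem compl_abs_lt_one : {x : ℝ | |x| < 1}ᶜ = {x : ℝ | 1 ≤ |x|} := by
  ext x; simp

theorem measurable_levyIntegrand (u : ℝ) : Measurable (levyIntegrand u) := by
  have := (measurable_id (α := ℝ)).indicator measurableSet_abs_lt_one
  unfold levyIntegrand
  refine Measurable.sub (by fun_prop) (Measurable.mul (by fun_prop) ?_)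
  exact Complex.measurable_ofReal.comp this

theorem re_levyIntegrand (u x : ℝ) : (levyIntegrand u x).re = Real.cos (u * x) - 1 := by
  have h : Complex.I * u * x = ((u * x : ℝ) : ℂ) * Complex.I := by push_cast; ring
  have h' : Complex.I * u * (({x : ℝ | |x| < 1}.indicator (fun y => y) x : ℝ) : ℂ)
      = ((u * {x : ℝ | |x| < 1}.indicator (fun y => y) x : ℝ) : ℂ) * Complex.I := by
    push_cast; ring
  rw [levyIntegrand, h, h', Complex.sub_re, Complex.sub_re, Complex.exp_ofReal_mul_I_re,
    Complex.re_ofReal_mul, Complex.I_re, Complex.one_re, mul_zero, sub_zero]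

theorem norm_exp_I_mul_mul (u x : ℝ) : ‖Complex.exp (Complex.I * u * x)‖ = 1 := by
  have h : Complex.I * u * x = ((u * x : ℝ) : ℂ) * Complex.I := by push_cast; ring
  rw [h, Complex.norm_exp_ofReal_mul_I]

theorem integrable_levyIntegrand {ν : Measure ℝ} (hν : IsLevyMeasure ν) {u : ℝ} (hu : |u| ≤ 1) :
    Integrable (levyIntegrand u) ν := by
  rw [← integrableOn_univ, ← Set.union_compl_self {x : ℝ | |x| < 1}, compl_abs_lt_one]
  refine IntegrableOn.union ?_ ?_
  · refine hν.integrableOn_sq.mono' (measurable_levyIntegrand u).aestronglyMeasurable ?_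
    filter_upwards [ae_restrict_mem measurableSet_abs_lt_one] with x hx
    have hx' : |x| < 1 := hx
    have hn : ‖Complex.I * u * x‖ = |u| * |x| := by simp
    have hle : |u| * |x| ≤ |x| := mul_le_of_le_one_left (abs_nonneg x) hu
    have hx1 : x ∈ {x : ℝ | |x| < 1} := hx
    rw [levyIntegrand, Set.indicator_of_mem hx1]
    refine (Complex.norm_exp_sub_one_sub_id_le (by rw [hn]; linarith)).trans ?_
    rw [hn]
    gcongr
  · refine IntegrableOn.of_bound hν.measure_one_le_abs_lt_top
      (measurable_levyIntegrand u).aestronglyMeasurable 2 ?_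
    filter_upwards [ae_restrict_mem measurableSet_one_le_abs] with x hx
    have hx' : x ∉ {x : ℝ | |x| < 1} := by simpa using hx
    rw [levyIntegrand, Set.indicator_of_notMem hx']
    simp only [Complex.ofReal_zero, mul_zero, sub_zero]
    refine (norm_sub_le _ _).trans ?_
    rw [norm_exp_I_mul_mul, norm_one]
    norm_num

/-- The Gaussian part and the small jumps both contribute nonnegatively to -Re ψ(u), and are
dropped. -/
theorem re_levyExponent_le {ν : Measure ℝ} (hν : IsLevyMeasure ν) (b : ℝ) (c : ℝ≥0) {u : ℝ}
    (hu : |u| ≤ 1) :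
    ∫⁻ x in {x : ℝ | 1 ≤ |x|}, ENNReal.ofReal (1 - Real.cos (u * x)) ∂ν
      ≤ ENNReal.ofReal (-(levyExponent b c ν u).re) := by
  have hint := integrable_levyIntegrand hν hu
  have hre : ∫ x, (1 - Real.cos (u * x)) ∂ν = -(∫ x, levyIntegrand u x ∂ν).re := by
    have h : (∫ x, levyIntegrand u x ∂ν).re = ∫ x, (levyIntegrand u x).re ∂ν :=
      (integral_re hint).symm
    rw [h, ← integral_neg]
    simp [re_levyIntegrand]
  have hint' : Integrable (fun x => 1 - Real.cos (u * x)) ν := by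
    refine hint.re.neg.congr (ae_of_all _ fun x => ?_)
    simp [re_levyIntegrand]
  refine (setLIntegral_le_lintegral _ _).trans ?_
  rw [← ofReal_integral_eq_lintegral_ofReal hint'
    (ae_of_all _ fun x => by simpa using Real.cos_le_one (u * x)), hre]
  refine ENNReal.ofReal_le_ofReal ?_
  have h2 : (levyExponent b c ν u).re
      = -(u ^ 2 * c / 2) + (∫ x, levyIntegrand u x ∂ν).re := by
    have e : levyExponent b c ν u = ((-(u ^ 2 * c / 2) : ℝ) : ℂ) + ((u * b : ℝ) : ℂ) * Complex.I
        + ∫ x, levyIntegrand u x ∂ν := by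
      simp only [levyExponent, levyIntegrand]
      push_cast; ring
    rw [e, Complex.add_re, Complex.add_re, Complex.ofReal_re, Complex.re_ofReal_mul,
      Complex.I_re, mul_zero, add_zero]
  rw [h2]
  have : 0 ≤ u ^ 2 * (c : ℝ) / 2 := by positivity
  linarith

/-- For |u| < 1 the u-derivative of the integrand is dominated by |x|² on small jumps and by |x| on
big ones. At u = 0 the small jumps cancel, and the big ones complete b to the compensated drift. -/
theorem hasDerivAt_levyExponent_zero {ν : Measure ℝ} (hν : IsLevyMeasure ν)
    (hint : IntegrableOn (fun x : ℝ => x) {x : ℝ | 1 ≤ |x|} ν) (b : ℝ) (c : ℝ≥0) :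
    HasDerivAt (levyExponent b c ν) (Complex.I * compensatedDrift b ν) 0 := by
  let F' : ℝ → ℝ → ℂ := fun u x => Complex.I * x * Complex.exp (Complex.I * u * x) -
    Complex.I * (({x : ℝ | |x| < 1}.indicator (fun y => y) x : ℝ) : ℂ)
  let bound : ℝ → ℝ := fun x => {x : ℝ | |x| < 1}.indicator (fun x => |x| ^ 2) x +
    {x : ℝ | 1 ≤ |x|}.indicator (fun x => |x|) x
  have hF'meas : Measurable (F' 0) := by
    refine Measurable.sub (by fun_prop) (Measurable.mul (by fun_prop) ?_)
    exact Complex.measurable_ofReal.comp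
      ((measurable_id (α := ℝ)).indicator measurableSet_abs_lt_one)
  have hbound : Integrable bound ν :=
    (hν.integrableOn_sq.integrable_indicator measurableSet_abs_lt_one).add
      (IntegrableOn.integrable_indicator (Integrable.abs hint) measurableSet_one_le_abs)
  have key := hasDerivAt_integral_of_dominated_loc_of_deriv_le (μ := ν) (𝕜 := ℝ) (E := ℂ)
    (F := levyIntegrand) (F' := F') (x₀ := 0) (s := Metric.ball 0 1) (bound := bound)
    (Metric.ball_mem_nhds 0 one_pos)
    (Eventually.of_forall fun u => (measurable_levyIntegrand u).aestronglyMeasurable)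
    (integrable_levyIntegrand hν (by simp)) hF'meas.aestronglyMeasurable
    (ae_of_all _ fun x u hu => by
      have hu : |u| < 1 := by simpa using hu
      by_cases hx : |x| < 1
      · have hx1 : x ∈ {x : ℝ | |x| < 1} := hx
        have hx2 : x ∉ {x : ℝ | 1 ≤ |x|} := by simpa using hx
        simp only [F', bound, Set.indicator_of_mem hx1, Set.indicator_of_notMem hx2, add_zero]
        have e : Complex.I * x * Complex.exp (Complex.I * u * x) - Complex.I * x
            = Complex.I * x * (Complex.exp (Complex.I * ((u * x : ℝ) : ℂ)) - 1) := by
          push_cast; ring_nf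
        rw [e, norm_mul, norm_mul, Complex.norm_I, one_mul, Complex.norm_real, Real.norm_eq_abs,
          sq]
        gcongr
        refine Real.norm_exp_I_mul_ofReal_sub_one_le.trans ?_
        rw [norm_mul, Real.norm_eq_abs, Real.norm_eq_abs]
        exact mul_le_of_le_one_left (abs_nonneg x) hu.le
      · have hx1 : x ∉ {x : ℝ | |x| < 1} := hx
        have hx2 : x ∈ {x : ℝ | 1 ≤ |x|} := by simpa using hx
        simp only [F', bound, Set.indicator_of_mem hx2, Set.indicator_of_notMem hx1, zero_add,
          Complex.ofReal_zero, mul_zero, sub_zero]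
        rw [norm_mul, norm_exp_I_mul_mul]
        simp) hbound
    (ae_of_all _ fun x u _ => by
      have hid : HasDerivAt (fun u : ℝ => (u : ℂ)) 1 u := Complex.ofRealCLM.hasDerivAt
      have h1 := (((hid.const_mul Complex.I).mul_const (x : ℂ)).cexp.sub_const 1).sub
        ((hid.const_mul Complex.I).mul_const
          (({x : ℝ | |x| < 1}.indicator (fun y => y) x : ℝ) : ℂ))
      refine h1.congr_deriv ?_
      simp only [F']
      ring)
  have hval : ∫ x, F' 0 x ∂ν = Complex.I * ((∫ x in {x : ℝ | 1 ≤ |x|}, x ∂ν : ℝ) : ℂ) := by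
    rw [← integral_indicator measurableSet_one_le_abs, ← integral_complex_ofReal, ← integral_const_mul]
    refine integral_congr_ae (ae_of_all _ fun x => ?_)
    by_cases hx : |x| < 1
    · have hx1 : x ∈ {x : ℝ | |x| < 1} := hx
      have hx2 : x ∉ {x : ℝ | 1 ≤ |x|} := by simpa using hx
      simp [F', Set.indicator_of_mem hx1, Set.indicator_of_notMem hx2]
    · have hx1 : x ∉ {x : ℝ | |x| < 1} := hx
      have hx2 : x ∈ {x : ℝ | 1 ≤ |x|} := by simpa using hx
      simp [F', Set.indicator_of_notMem hx1, Set.indicator_of_mem hx2]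
  have hid : HasDerivAt (fun u : ℝ => (u : ℂ)) 1 0 := Complex.ofRealCLM.hasDerivAt
  have h := (((hid.const_mul Complex.I).mul_const (b : ℂ)).sub
    (((hid.pow 2).mul_const ((c : ℝ) : ℂ)).div_const 2)).add key.2
  refine h.congr_deriv ?_
  rw [hval, compensatedDrift]
  push_cast
  simp
  ring

theorem hasDerivAt_integral_exp_zero {Ω : Type*} {mΩ : MeasurableSpace Ω} {P : Measure Ω}
    [IsFiniteMeasure P] {X : Ω → ℝ} (hX : Integrable X P) :
    HasDerivAt (fun u : ℝ => ∫ ω, Complex.exp (Complex.I * u * X ω) ∂P)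
      (Complex.I * ((∫ ω, X ω ∂P : ℝ) : ℂ)) 0 := by
  have hm := hX.aestronglyMeasurable
  have hm' : AEStronglyMeasurable (fun ω => (X ω : ℂ)) P :=
    Complex.continuous_ofReal.comp_aestronglyMeasurable hm
  have hme : ∀ u : ℝ, AEStronglyMeasurable (fun ω => Complex.exp (Complex.I * u * X ω)) P :=
    fun u => Complex.continuous_exp.comp_aestronglyMeasurable (hm'.const_mul _)
  have key := hasDerivAt_integral_of_dominated_loc_of_deriv_le (μ := P) (𝕜 := ℝ) (E := ℂ)
    (F := fun u ω => Complex.exp (Complex.I * u * X ω))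
    (F' := fun u ω => Complex.exp (Complex.I * u * X ω) * (Complex.I * X ω)) (x₀ := 0)
    (bound := fun ω => |X ω|) Filter.univ_mem (Eventually.of_forall hme)
    (by simp) ((hme 0).mul (hm'.const_mul _))
    (ae_of_all _ fun ω u _ => by
      rw [norm_mul, norm_exp_I_mul_mul]
      simp) hX.abs
    (ae_of_all _ fun ω u _ => by
      have hid : HasDerivAt (fun u : ℝ => (u : ℂ)) 1 u := Complex.ofRealCLM.hasDerivAt
      refine ((hid.const_mul Complex.I).mul_const (X ω : ℂ)).cexp.congr_deriv ?_
      ring)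
  refine key.2.congr_deriv ?_
  rw [← integral_complex_ofReal, ← integral_const_mul]
  simp

/-! ### Moment of the Lévy measure and mean of the process -/

namespace HasLevyTriplet

variable {Ω : Type*} {mΩ : MeasurableSpace Ω} {P : Measure Ω} [IsProbabilityMeasure P]
  {T : ℝ≥0∞} {L : TimeSet T → Ω → ℝ} {b : ℝ} {c : ℝ≥0} {ν : Measure ℝ}

/-- `t Re (-ψ(u)) ≤ 2 E[1 - cos (u L_t)]` as long as `|E[exp (i u L_t)]| ≥ 1 / 2`. -/
theorem neg_re_levyExponent_le (h : HasLevyTriplet L P b c ν) (t : TimeSet T)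
    (hint : Integrable (L t) P) {u : ℝ}
    (hu : 1 / 2 ≤ ‖∫ ω, Complex.exp (Complex.I * u * L t ω) ∂P‖) :
    ((t : ℝ≥0) : ℝ) * -(levyExponent b c ν u).re ≤ 2 * ∫ ω, (1 - Real.cos (u * L t ω)) ∂P := by
  have hm' : AEStronglyMeasurable (fun ω => (L t ω : ℂ)) P :=
    Complex.continuous_ofReal.comp_aestronglyMeasurable hint.aestronglyMeasurable
  have hexp : Integrable (fun ω => Complex.exp (Complex.I * u * L t ω)) P :=
    Integrable.of_bound (Complex.continuous_exp.comp_aestronglyMeasurable (hm'.const_mul _)) 1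
      (ae_of_all _ fun ω => (norm_exp_I_mul_mul u (L t ω)).le)
  have hre : ∀ ω, (Complex.exp (Complex.I * u * L t ω)).re = Real.cos (u * L t ω) := fun ω => by
    have e : Complex.I * u * L t ω = ((u * L t ω : ℝ) : ℂ) * Complex.I := by push_cast; ring
    rw [e, Complex.exp_ofReal_mul_I_re]
  have hcos : Integrable (fun ω => Real.cos (u * L t ω)) P :=
    hexp.re.congr (ae_of_all _ fun ω => hre ω)
  have h1 : (∫ ω, Complex.exp (Complex.I * u * L t ω) ∂P).re = ∫ ω, Real.cos (u * L t ω) ∂P := by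
    have : (∫ ω, Complex.exp (Complex.I * u * L t ω) ∂P).re
        = ∫ ω, (Complex.exp (Complex.I * u * L t ω)).re ∂P := (integral_re hexp).symm
    simp only [this, hre]
  have h2 := Complex.re_le_norm (∫ ω, Complex.exp (Complex.I * u * L t ω) ∂P)
  rw [h1] at h2
  have h3 : ‖∫ ω, Complex.exp (Complex.I * u * L t ω) ∂P‖
      = Real.exp (((t : ℝ≥0) : ℝ) * (levyExponent b c ν u).re) := by
    rw [h.levy_khintchine t u, Complex.norm_exp, Complex.re_ofReal_mul]
  rw [integral_sub (integrable_const 1) hcos]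
  simp only [integral_const, probReal_univ, one_smul]
  rw [h3] at h2 hu
  set y := ((t : ℝ≥0) : ℝ) * (levyExponent b c ν u).re with hy
  -- If y ≤ 0, then -y ≤ e^{-y} - 1 = e^{-y}(1 - e^y) ≤ 2(1 - e^y), because e^y ≥ 1/2; and e^y is at
  -- least E[cos(u L_t)]. If y > 0, the left side is negative.
  have h4 := Real.add_one_le_exp (-y)
  have h5 : Real.exp y * Real.exp (-y) = 1 := by rw [← Real.exp_add]; simp
  have h6 : ((t : ℝ≥0) : ℝ) * -(levyExponent b c ν u).re = -y := by rw [hy]; ring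
  rw [h6]
  rcases le_or_gt y 0 with hy0 | hy0
  · nlinarith [Real.exp_pos y]
  · have h7 : ∫ ω, Real.cos (u * L t ω) ∂P ≤ ∫ _, (1 : ℝ) ∂P :=
      integral_mono hcos (integrable_const 1) fun ω => Real.cos_le_one _
    simp at h7
    linarith

theorem integrableOn_one_le_abs (h : HasLevyTriplet L P b c ν) {t : TimeSet T}
    (ht : 0 < (t : ℝ≥0)) (hmeas : Measurable (L t)) (hint : Integrable (L t) P) :
    IntegrableOn (fun x : ℝ => x) {x : ℝ | 1 ≤ |x|} ν := by
  have hν := h.isLevyMeasure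
  have ht' : 0 < ((t : ℝ≥0) : ℝ) := by exact_mod_cast ht
  -- The characteristic function is continuous at 0 with value 1.
  obtain ⟨δ, hδ0, hδ1, hδ⟩ : ∃ δ : ℝ, 0 < δ ∧ δ ≤ 1 ∧ ∀ u ∈ Set.Ioo 0 δ,
      1 / 2 ≤ ‖∫ ω, Complex.exp (Complex.I * u * L t ω) ∂P‖ := by
    have hc := (hasDerivAt_integral_exp_zero hint).continuousAt.norm
    have hlt : ∀ᶠ u : ℝ in 𝓝 0, 1 / 2 < ‖∫ ω, Complex.exp (Complex.I * u * L t ω) ∂P‖ :=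
      hc.eventually (lt_mem_nhds (by norm_num))
    obtain ⟨ε, hε, hball⟩ := Metric.eventually_nhds_iff.1 hlt
    refine ⟨min ε 1, lt_min hε one_pos, min_le_right _ _, fun u hu => (hball ?_).le⟩
    rw [dist_zero_right, Real.norm_eq_abs, abs_of_pos hu.1]
    exact hu.2.trans_le (min_le_left _ _)
  -- Supplies the `SFinite` instance that Tonelli needs.
  have : IsFiniteMeasure (ν.restrict {x : ℝ | 1 ≤ |x|}) :=
    ⟨by simpa using hν.measure_one_le_abs_lt_top⟩
  have hpt : ∀ u ∈ Set.Ioo 0 δ,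
      ∫⁻ x in {x : ℝ | 1 ≤ |x|}, ENNReal.ofReal ((1 - Real.cos (u * x)) / u ^ 2) ∂ν
        ≤ ENNReal.ofReal (2 / ((t : ℝ≥0) : ℝ)) *
          ∫⁻ ω, ENNReal.ofReal ((1 - Real.cos (u * L t ω)) / u ^ 2) ∂P := by
    intro u hu
    have hu0 := hu.1
    have hu1 : |u| ≤ 1 := by rw [abs_of_pos hu0]; exact hu.2.le.trans hδ1
    have hcosint : Integrable (fun ω => 1 - Real.cos (u * L t ω)) P := by
      refine Integrable.of_bound (by fun_prop) 2 (ae_of_all _ fun ω => ?_)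
      rw [Real.norm_eq_abs, abs_le]
      constructor <;> linarith [Real.neg_one_le_cos (u * L t ω), Real.cos_le_one (u * L t ω)]
    have hmain : ∫⁻ x in {x : ℝ | 1 ≤ |x|}, ENNReal.ofReal (1 - Real.cos (u * x)) ∂ν
        ≤ ENNReal.ofReal (2 / ((t : ℝ≥0) : ℝ)) *
          ∫⁻ ω, ENNReal.ofReal (1 - Real.cos (u * L t ω)) ∂P := by
      refine (re_levyExponent_le hν b c hu1).trans ?_
      rw [← ofReal_integral_eq_lintegral_ofReal hcosint
        (ae_of_all _ fun ω => by simpa using Real.cos_le_one (u * L t ω)),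
        ← ENNReal.ofReal_mul (by positivity)]
      refine ENNReal.ofReal_le_ofReal ?_
      have := h.neg_re_levyExponent_le t hint (hδ u hu)
      rw [div_mul_eq_mul_div, le_div_iff₀ ht']
      linarith
    have hdiv : ∀ y : ℝ, ENNReal.ofReal (y / u ^ 2)
        = ENNReal.ofReal y * ENNReal.ofReal (u ^ 2)⁻¹ := fun y => by
      rw [div_eq_mul_inv, ENNReal.ofReal_mul' (by positivity)]
    simp only [hdiv]
    rw [lintegral_mul_const _ (by fun_prop), lintegral_mul_const _ (by fun_prop), ← mul_assoc]
    gcongr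
  have hle : ENNReal.ofReal (2 / Real.pi ^ 2 * δ) *
      ∫⁻ x in {x : ℝ | 1 ≤ |x|}, ENNReal.ofReal |x| ∂ν < ∞ := by
    calc _ = ∫⁻ x in {x : ℝ | 1 ≤ |x|}, ENNReal.ofReal (2 / Real.pi ^ 2 * δ * |x|) ∂ν := by
          rw [← lintegral_const_mul _ (by fun_prop)]
          refine lintegral_congr fun x => ?_
          rw [← ENNReal.ofReal_mul (by positivity)]
      _ ≤ ∫⁻ x in {x : ℝ | 1 ≤ |x|}, cosWeight δ x ∂ν :=
          setLIntegral_mono' measurableSet_one_le_abs fun x hx => le_cosWeight hδ0 hδ1 hx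
      _ = ∫⁻ u in Set.Ioo 0 δ, ∫⁻ x in {x : ℝ | 1 ≤ |x|},
            ENNReal.ofReal ((1 - Real.cos (u * x)) / u ^ 2) ∂ν :=
          lintegral_cosWeight measurable_id δ
      _ ≤ ∫⁻ u in Set.Ioo 0 δ, ENNReal.ofReal (2 / ((t : ℝ≥0) : ℝ)) *
            ∫⁻ ω, ENNReal.ofReal ((1 - Real.cos (u * L t ω)) / u ^ 2) ∂P :=
          setLIntegral_mono' measurableSet_Ioo hpt
      _ = ENNReal.ofReal (2 / ((t : ℝ≥0) : ℝ)) * ∫⁻ ω, cosWeight δ (L t ω) ∂P := by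
          rw [lintegral_const_mul' _ _ ENNReal.ofReal_ne_top, lintegral_cosWeight hmeas]
      _ ≤ ENNReal.ofReal (2 / ((t : ℝ≥0) : ℝ)) * ∫⁻ ω, ENNReal.ofReal (3 * |L t ω|) ∂P := by
          gcongr
          exact cosWeight_le _ _
      _ < ∞ := by
          have h3 : Integrable (fun ω => 3 * |L t ω|) P := hint.abs.const_mul 3
          exact ENNReal.mul_lt_top ENNReal.ofReal_lt_top
            ((hasFiniteIntegral_iff_ofReal (ae_of_all _ fun ω => by positivity)).1 h3.2)
  have hfin := ENNReal.lt_top_of_mul_ne_top_right hle.ne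
    (ENNReal.ofReal_pos.2 (by positivity)).ne'
  refine ⟨by fun_prop, ?_⟩
  rw [hasFiniteIntegral_iff_norm]
  exact hfin

theorem integral_eq (h : HasLevyTriplet L P b c ν)
    (hν : IntegrableOn (fun x : ℝ => x) {x : ℝ | 1 ≤ |x|} ν) (t : TimeSet T)
    (hint : Integrable (L t) P) :
    ∫ ω, L t ω ∂P = ((t : ℝ≥0) : ℝ) * compensatedDrift b ν := by
  have h1 := hasDerivAt_integral_exp_zero hint
  have h2 := ((hasDerivAt_levyExponent_zero h.isLevyMeasure hν b c).const_mul
    ((((t : ℝ≥0) : ℝ) : ℂ))).cexp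
  have h0 : levyExponent b c ν 0 = 0 := by simp [levyExponent]
  have he : (fun u : ℝ => ∫ ω, Complex.exp (Complex.I * u * L t ω) ∂P)
      = fun u => Complex.exp (((t : ℝ≥0) : ℝ) * levyExponent b c ν u) :=
    funext (h.levy_khintchine t)
  rw [he] at h1
  have h3 := h1.unique h2
  rw [h0, mul_zero, Complex.exp_zero, one_mul, mul_left_comm] at h3
  exact_mod_cast mul_left_cancel₀ Complex.I_ne_zero h3

end HasLevyTriplet

/-! ### Conditional expectations and the martingale criterion -/

theorem IsLevyProcess.condExp_ae_eq {Ω : Type*} {mΩ : MeasurableSpace Ω} {P : Measure Ω}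
    [IsProbabilityMeasure P] {T : ℝ≥0∞} {ℱ : Filtration (TimeSet T) mΩ} {L : TimeSet T → Ω → ℝ}
    (hL : IsLevyProcess L ℱ P) (hint : ∀ t, Integrable (L t) P) {s t : TimeSet T} (hst : s ≤ t) :
    P[L t | ℱ s] =ᵐ[P] fun ω => L s ω + (∫ ω, L t ω ∂P - ∫ ω, L s ω ∂P) := by
  have hs : P[L s | ℱ s] = L s :=
    condExp_of_stronglyMeasurable (ℱ.le s) (hL.adapted s).stronglyMeasurable (hint s)
  -- Independence of increments is only assumed for s < t.
  rcases hst.eq_or_lt with rfl | hlt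
  · rw [hs]
    simp
  have hm : ∀ r, Measurable (L r) := fun r => (hL.adapted r).mono (ℱ.le r) le_rfl
  have hind : P[fun ω => L t ω - L s ω | ℱ s] =ᵐ[P] fun _ => ∫ ω, (L t ω - L s ω) ∂P :=
    condExp_indep_eq ((hm t).sub (hm s)).comap_le (ℱ.le s)
      (comap_measurable (fun ω => L t ω - L s ω)).stronglyMeasurable
      (hL.indep_increments s t hlt)
  have hadd : P[L s + (fun ω => L t ω - L s ω) | ℱ s]
      =ᵐ[P] P[L s | ℱ s] + P[fun ω => L t ω - L s ω | ℱ s] :=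
    condExp_add (hint s) ((hint t).sub (hint s)) (ℱ s)
  have e : L s + (fun ω => L t ω - L s ω) = L t := by ext ω; simp
  rw [e, hs] at hadd
  filter_upwards [hadd, hind] with ω h1 h2
  rw [h1, Pi.add_apply, h2, integral_sub (hint t) (hint s)]

/-- Martingale criterion for Lévy processes with finite first moment. The first part of the
conclusion says that the compensated drift is well defined. -/
theorem proposition10p1 {Ω : Type*} {mΩ : MeasurableSpace Ω} (P : Measure Ω)
    [IsProbabilityMeasure P] (T : ℝ≥0∞) (hT : 0 < T) (ℱ : Filtration (TimeSet T) mΩ)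
    (L : TimeSet T → Ω → ℝ) (hL : IsLevyProcess L ℱ P)
    (b : ℝ) (c : ℝ≥0) (ν : Measure ℝ) (htriplet : HasLevyTriplet L P b c ν)
    (hmoment : ∀ t, Integrable (L t) P) :
    IntegrableOn (fun x : ℝ => x) {x : ℝ | 1 ≤ |x|} ν ∧
      (Martingale L ℱ P ↔ compensatedDrift b ν = 0) ∧
      (0 < compensatedDrift b ν → Submartingale L ℱ P) ∧
      (compensatedDrift b ν < 0 → Supermartingale L ℱ P) := by
  -- A positive time is needed for the law of L to carry information on b and ν; it must be finite
  -- even if T = ∞.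
  obtain ⟨t₀, ht₀⟩ : ∃ t : TimeSet T, 0 < (t : ℝ≥0) := by
    obtain ⟨r, hr0, hrT⟩ := ENNReal.lt_iff_exists_nnreal_btwn.1 hT
    exact ⟨⟨r, hrT.le⟩, by exact_mod_cast hr0⟩
  have hm : ∀ r, Measurable (L r) := fun r => (hL.adapted r).mono (ℱ.le r) le_rfl
  have hν := htriplet.integrableOn_one_le_abs ht₀ (hm t₀) (hmoment t₀)
  have hE := fun t => htriplet.integral_eq hν t (hmoment t)
  have hadapted : StronglyAdapted ℱ L := fun t => (hL.adapted t).stronglyMeasurable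
  have hcond : ∀ s t : TimeSet T, s ≤ t → P[L t | ℱ s] =ᵐ[P]
      fun ω => L s ω + (((t : ℝ≥0) : ℝ) - ((s : ℝ≥0) : ℝ)) * compensatedDrift b ν := by
    intro s t hst
    have h := hL.condExp_ae_eq hmoment hst
    rwa [hE, hE, ← sub_mul] at h
  have hnn : ∀ s t : TimeSet T, s ≤ t → 0 ≤ ((t : ℝ≥0) : ℝ) - ((s : ℝ≥0) : ℝ) :=
    fun s t hst => sub_nonneg.2 (by exact_mod_cast hst)
  refine ⟨hν, ⟨fun hM => ?_, fun hb => ⟨hadapted, fun s t hst => ?_⟩⟩,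
    fun hb => ⟨hadapted, fun s t hst => ?_, hmoment⟩,
    fun hb => ⟨hadapted, fun s t hst => ?_, hmoment⟩⟩
  -- A martingale has constant mean; times 0 and t₀ give 0 = t₀ b.
  · have h0 : (⟨0, zero_le⟩ : TimeSet T) ≤ t₀ := Subtype.mk_le_mk.2 zero_le
    have h := hM.setIntegral_eq h0 MeasurableSet.univ
    rw [setIntegral_univ, setIntegral_univ, hE, hE] at h
    have ht : ((t₀ : ℝ≥0) : ℝ) ≠ 0 := by exact_mod_cast ht₀.ne'
    simpa [ht, eq_comm] using h
  · filter_upwards [hcond s t hst] with ω h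
    rw [h, hb, mul_zero, add_zero]
  · filter_upwards [hcond s t hst] with ω h
    rw [h]
    exact le_add_of_nonneg_right (mul_nonneg (hnn s t hst) hb.le)
  · filter_upwards [hcond s t hst] with ω h
    rw [h]
    exact add_le_of_nonpos_right (mul_nonpos_of_nonneg_of_nonpos (hnn s t hst) hb.le)
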